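/- Let $\omega\in\mathbb{R}$, $\omega\neq 0$. Let $p\in C^1([0,\infty))$ satisfy $p(t)>0$ and $p'(t)<0$ for all $t\ge 0$, $\int_0^\infty p(t)\,dt=\infty$ and $\int_0^\infty p(t)^2\,dt<\infty$, and let $f:[0,\infty)\to\mathbb{R}$ be locally integrable, $f\in L^1_{\mathrm{loc}}([0,\infty))$. Put $$A(t)=\exp\Big(\tfrac12\int_0^t p(s)\,ds\Big),\qquad y_1(t)=\int_0^t e^{-\omega^2(t-s)}f(s)\,ds,\qquad y_2(t)=\int_0^t e^{-\omega^2(t-s)}y_1(s)\,ds$$ for $t\ge 0$. Let $\xi_0,\xi_1\in\mathbb{R}$ and let $x$ be a solution of $$x''(t)+p(t)x'(t)+\omega^2x(t)=f(t),\quad t\ge 0,\qquad x(0)=\xi_0,\quad x'(0)=\xi_1,$$ in the sense that $x$ is differentiable on $[0,\infty)$, $x'$ is locally absolutely continuous, and the equation holds for almost every $t\ge 0$. Suppose that $y_2(t)=o(1/A(t))$ as $t\to\infty$ and that $\int_0^\infty A(s)\,|y_2(s)|\,ds<\infty$. Then there exist constants $c_1,c_2\in\mathbb{R}$ such that $$x(t)=\frac{c_1\sin(\omega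 t)+c_2\cos(\omega t)}{A(t)}+o\!\left(\frac1{A(t)}\right)\qquad\text{as } t\to\infty .$$ In particular (taking $f=0$, so that $y_2=0$) every solution of the unforced equation has this form, and so the forced solution keeps the leading-order asymptotic form of the unforced one. -/

import Mathlib

open Set Filter Topology MeasureTheory Asymptotics

noncomputable section

namespace DampedOscillator

/-- Standing hypotheses on the damping coefficient `p` on `[0, ∞)`. At the endpoint `0` the
derivative is the one-sided one. -/
structure IsDamping (p : ℝ → ℝ) : Prop where
  contDiffOn : ContDiffOn ℝ 1 p (Ici 0)
  pos : ∀ t, 0 ≤ t → 0 < p t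
  deriv_neg : ∀ t, 0 ≤ t → derivWithin p (Ici 0) t < 0
  not_integrable : ¬ IntegrableOn p (Ici 0)
  sq_integrable : IntegrableOn (fun t => p t ^ 2) (Ici 0)

/-- `x` solves `x'' + p x' + ω² x = f` on `[0, ∞)` with `x 0 = ξ₀`, `x' 0 = ξ₁`. Since `f` is only
locally integrable this is meant in the usual (Carathéodory) sense: `x` is differentiable on
`[0, ∞)`, its derivative `v` is locally absolutely continuous there, and the equation holds at
almost every `t ≥ 0`. -/
def IsSolution (ω : ℝ) (p f : ℝ → ℝ) (ξ₀ ξ₁ : ℝ) (x : ℝ → ℝ) : Prop :=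
  ∃ v : ℝ → ℝ,
    (∀ t, 0 ≤ t → HasDerivWithinAt x (v t) (Ici 0) t) ∧
    (∀ T, 0 ≤ T → AbsolutelyContinuousOnInterval v 0 T) ∧
    (∀ᵐ t, 0 ≤ t → ∃ a : ℝ, HasDerivAt v a t ∧ a + p t * v t + ω ^ 2 * x t = f t) ∧
    x 0 = ξ₀ ∧ v 0 = ξ₁

/-- `y₁ = e_{ω²} * f`, where `e_{ω²}(t) = exp (-ω² t)`. -/
def y₁ (ω : ℝ) (f : ℝ → ℝ) (t : ℝ) : ℝ :=
  ∫ s in (0 : ℝ)..t, Real.exp (-(ω ^ 2) * (t - s)) * f s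

/-- `y₂ = e_{ω²} * y₁`. -/
def y₂ (ω : ℝ) (f : ℝ → ℝ) (t : ℝ) : ℝ :=
  ∫ s in (0 : ℝ)..t, Real.exp (-(ω ^ 2) * (t - s)) * y₁ ω f s

/-- `A(t) = exp (½ ∫₀ᵗ p)`. -/
def A (p : ℝ → ℝ) (t : ℝ) : ℝ :=
  Real.exp ((1 / 2) * ∫ s in (0 : ℝ)..t, p s)

end DampedOscillator

end

namespace DampedOscillator

/-! ### A linear growth criterion for convergence at infinity -/

/-! Subtracting `y₂` from `x` removes the rough forcing: z = x - y₂ satisfies z'' + p z' + ω² z =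
(2ω² - p) y₂' + (ω⁴ - ω²) y₂. The substitution u = A z then removes the damping, giving u'' + ω² u =
(p'/2 + p²/4) u plus forcing. Since y₂' is not controlled, it is absorbed into the second unknown w
of a first-order system, leaving only multiples of A y₂. All coefficients are then integrable: p'
because p is monotone and bounded, p² and A y₂ by hypothesis.

An integrable perturbation of the harmonic oscillator keeps its asymptotics: in rotating coordinates
(a, b) the derivatives are at most k (1 + |a| + |b|) with k integrable, so a and b stay bounded and
hence converge. Finally A x = u + A y₂ and A y₂ → 0. -/

theorem exists_tendsto_of_abs_deriv_le {a b a' b' k : ℝ → ℝ} {T : ℝ}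
    (ha : ∀ t, T < t → HasDerivAt a (a' t) t) (hb : ∀ t, T < t → HasDerivAt b (b' t) t)
    (hk : IntegrableOn k (Ioi T))
    (ha' : ∀ t, T < t → |a' t| ≤ k t * (1 + |a t| + |b t|))
    (hb' : ∀ t, T < t → |b' t| ≤ k t * (1 + |a t| + |b t|)) :
    ∃ α β : ℝ, Tendsto a atTop (𝓝 α) ∧ Tendsto b atTop (𝓝 β) := by
  have hk0 : ∀ t, T < t → 0 ≤ k t := fun t ht => by
    have h1 : 0 < 1 + |a t| + |b t| := by positivity
    exact nonneg_of_mul_nonneg_left ((abs_nonneg _).trans (ha' t ht)) h1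
  -- The logarithmic energy has integrably bounded growth.
  set L : ℝ → ℝ := fun t => Real.log (1 + a t ^ 2 + b t ^ 2) with hL
  have hpos : ∀ t, 0 < 1 + a t ^ 2 + b t ^ 2 := fun t => by positivity
  have hLd : ∀ t, T < t →
      HasDerivAt L ((2 * a t * a' t + 2 * b t * b' t) / (1 + a t ^ 2 + b t ^ 2)) t := by
    intro t ht
    have h := ((((ha t ht).pow 2).const_add 1).add ((hb t ht).pow 2)).log (hpos t).ne'
    convert! h using 1
    simp
  have hLle : ∀ t, T < t →
      (2 * a t * a' t + 2 * b t * b' t) / (1 + a t ^ 2 + b t ^ 2) ≤ 6 * k t := by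
    intro t ht
    rw [div_le_iff₀ (hpos t)]
    have h1 : a t * a' t ≤ |a t| * (k t * (1 + |a t| + |b t|)) :=
      (le_abs_self _).trans (by rw [abs_mul]; gcongr; exact ha' t ht)
    have h2 : b t * b' t ≤ |b t| * (k t * (1 + |a t| + |b t|)) :=
      (le_abs_self _).trans (by rw [abs_mul]; gcongr; exact hb' t ht)
    have h3 : (|a t| + |b t|) * (1 + |a t| + |b t|) ≤ 3 * (1 + a t ^ 2 + b t ^ 2) := by
      rw [← sq_abs (a t), ← sq_abs (b t)]
      nlinarith [sq_nonneg (|a t| - |b t|), sq_nonneg (|a t| - 1), sq_nonneg (|b t| - 1)]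
    nlinarith [mul_le_mul_of_nonneg_left h3 (hk0 t ht)]
  -- Nothing is known at T itself, so the estimate starts strictly to its right.
  set S : ℝ := T + 1
  have hLb : ∀ t, S ≤ t → L t ≤ L S + ∫ s in Ioi T, 6 * k s := by
    intro t ht
    have hsub : Icc S t ⊆ Ioi T := fun s hs => lt_of_lt_of_le (lt_add_one T) hs.1
    have h1 := intervalIntegral.sub_le_integral_of_hasDeriv_right_of_le ht
      (fun s hs => (hLd s (hsub hs)).continuousAt.continuousWithinAt)
      (fun s hs => (hLd s (hsub (Ioo_subset_Icc_self hs))).hasDerivWithinAt)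
      ((hk.mono_set hsub).const_mul 6)
      (fun s hs => hLle s (hsub (Ioo_subset_Icc_self hs)))
    rw [intervalIntegral.integral_of_le ht] at h1
    have h2 : ∫ s in Ioc S t, 6 * k s ≤ ∫ s in Ioi T, 6 * k s := by
      refine setIntegral_mono_set (hk.const_mul 6) ?_
        (Ioc_subset_Icc_self.trans hsub).eventuallyLE
      filter_upwards [self_mem_ae_restrict measurableSet_Ioi] with s hs
      exact mul_nonneg (by norm_num) (hk0 s hs)
    linarith
  set C : ℝ := Real.exp (L S + ∫ s in Ioi T, 6 * k s)
  have hC : ∀ t, S ≤ t → 1 + |a t| + |b t| ≤ 3 * C := by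
    intro t ht
    have h1 : 1 + a t ^ 2 + b t ^ 2 ≤ C := by
      rw [← Real.exp_log (hpos t)]
      exact Real.exp_le_exp.2 (hLb t ht)
    rw [← sq_abs (a t), ← sq_abs (b t)] at h1
    nlinarith [sq_nonneg (|a t| - 1), sq_nonneg (|b t| - 1)]
  have hST : Ioi S ⊆ Ioi T := Ioi_subset_Ioi (lt_add_one T).le
  -- With a and b bounded, each derivative is dominated by 3C k, hence integrable; its measurability
  -- comes from that of `deriv g`.
  have key : ∀ g g' : ℝ → ℝ, (∀ t, T < t → HasDerivAt g (g' t) t) →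
      (∀ t, T < t → |g' t| ≤ k t * (1 + |a t| + |b t|)) → ∃ γ, Tendsto g atTop (𝓝 γ) := by
    intro g g' hg hg'
    refine ⟨_, tendsto_limUnder_of_hasDerivAt_of_integrableOn_Ioi
      (fun t ht => hg t (hST ht)) (a := S) ?_⟩
    refine Integrable.mono' ((hk.mono_set hST).mul_const (3 * C)) ?_ ?_
    · refine (measurable_deriv g).aestronglyMeasurable.congr ?_
      filter_upwards [self_mem_ae_restrict measurableSet_Ioi] with t ht
      exact (hg t (hST ht)).deriv
    · filter_upwards [self_mem_ae_restrict measurableSet_Ioi] with t ht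
      exact (hg' t (hST ht)).trans
        (mul_le_mul_of_nonneg_left (hC t (mem_Ioi.1 ht).le) (hk0 t (hST ht)))
  obtain ⟨α, hα⟩ := key a a' ha ha'
  obtain ⟨β, hβ⟩ := key b b' hb hb'
  exact ⟨α, β, hα, hβ⟩

/-- Solutions of a first-order system that is an integrable perturbation of the harmonic
oscillator are asymptotic to harmonic oscillations. -/
theorem exists_tendsto_sub_harmonic {ω : ℝ} (hω : ω ≠ 0) {u w q r s : ℝ → ℝ} {T : ℝ}
    (hu : ∀ t, T < t → HasDerivAt u (w t + r t) t)
    (hw : ∀ t, T < t → HasDerivAt w (-ω ^ 2 * u t + q t * u t + s t) t)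
    (hq : IntegrableOn q (Ioi T)) (hr : IntegrableOn r (Ioi T)) (hs : IntegrableOn s (Ioi T)) :
    ∃ c₁ c₂ : ℝ, Tendsto
      (fun t => u t - (c₁ * Real.sin (ω * t) + c₂ * Real.cos (ω * t))) atTop (𝓝 0) := by
  have hsin : ∀ t, HasDerivAt (fun t => Real.sin (ω * t)) (Real.cos (ω * t) * ω) t := fun t => by
    simpa using (((hasDerivAt_id t).const_mul ω).sin)
  have hcos : ∀ t, HasDerivAt (fun t => Real.cos (ω * t)) (-Real.sin (ω * t) * ω) t := fun t => by
    simpa using (((hasDerivAt_id t).const_mul ω).cos)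
  -- Variation of parameters: a and b are constant along the unperturbed flow, so only q, r, s enter
  -- their derivatives.
  set a : ℝ → ℝ := fun t => u t * Real.cos (ω * t) - w t * Real.sin (ω * t) / ω with ha
  set b : ℝ → ℝ := fun t => u t * Real.sin (ω * t) + w t * Real.cos (ω * t) / ω with hb
  have hrot : ∀ t, u t = a t * Real.cos (ω * t) + b t * Real.sin (ω * t) := fun t => by
    simp only [ha, hb]
    linear_combination (-u t) * Real.sin_sq_add_cos_sq (ω * t)
  set a' : ℝ → ℝ := fun t =>
    r t * Real.cos (ω * t) - (q t * u t + s t) * Real.sin (ω * t) / ω with ha'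
  set b' : ℝ → ℝ := fun t =>
    r t * Real.sin (ω * t) + (q t * u t + s t) * Real.cos (ω * t) / ω with hb'
  set k : ℝ → ℝ := fun t => |r t| + (|q t| + |s t|) / |ω| with hk
  have hω' : 0 < |ω| := abs_pos.2 hω
  have hule : ∀ t, |u t| ≤ |a t| + |b t| := fun t => by
    rw [hrot t]
    refine (abs_add_le _ _).trans ?_
    rw [abs_mul, abs_mul]
    exact add_le_add (mul_le_of_le_one_right (abs_nonneg _) (Real.abs_cos_le_one _))
      (mul_le_of_le_one_right (abs_nonneg _) (Real.abs_sin_le_one _))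
  have hkey : ∀ t, |r t| + |q t * u t + s t| / |ω| ≤ k t * (1 + |a t| + |b t|) := fun t => by
    have h1 : |q t * u t + s t| ≤ (|q t| + |s t|) * (1 + |a t| + |b t|) := by
      refine (abs_add_le _ _).trans ?_
      rw [abs_mul]
      nlinarith [mul_le_mul_of_nonneg_left (hule t) (abs_nonneg (q t)), abs_nonneg (q t),
        mul_nonneg (abs_nonneg (s t)) (abs_nonneg (a t)),
        mul_nonneg (abs_nonneg (s t)) (abs_nonneg (b t))]
    have h2 : |r t| ≤ |r t| * (1 + |a t| + |b t|) :=
      le_mul_of_one_le_right (abs_nonneg _) (by linarith [abs_nonneg (a t), abs_nonneg (b t)])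
    have h3 := div_le_div_of_nonneg_right h1 hω'.le
    simp only [hk]
    rw [add_mul, div_mul_eq_mul_div]
    exact add_le_add h2 h3
  have hdiv : ∀ x y : ℝ, |y| ≤ 1 → |x * y / ω| ≤ |x| / |ω| := fun x y hy => by
    rw [abs_div, abs_mul]
    exact div_le_div_of_nonneg_right (mul_le_of_le_one_right (abs_nonneg _) hy) hω'.le
  obtain ⟨α, β, hα, hβ⟩ := exists_tendsto_of_abs_deriv_le (a := a) (b := b) (a' := a') (b' := b')
    (k := k) (T := T)
    (fun t ht => by
      refine (((hu t ht).mul (hcos t)).sub (((hw t ht).mul (hsin t)).div_const ω)).congr_deriv ?_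
      simp only [ha']
      field_simp
      ring)
    (fun t ht => by
      refine (((hu t ht).mul (hsin t)).add (((hw t ht).mul (hcos t)).div_const ω)).congr_deriv ?_
      simp only [hb']
      field_simp
      ring)
    (hr.abs.add ((hq.abs.add hs.abs).div_const _))
    (fun t _ => ((abs_sub _ _).trans (add_le_add
      ((abs_mul _ _).trans_le (mul_le_of_le_one_right (abs_nonneg _) (Real.abs_cos_le_one _)))
      (hdiv _ _ (Real.abs_sin_le_one _)))).trans (hkey t))
    (fun t _ => ((abs_add_le _ _).trans (add_le_add
      ((abs_mul _ _).trans_le (mul_le_of_le_one_right (abs_nonneg _) (Real.abs_sin_le_one _)))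
      (hdiv _ _ (Real.abs_cos_le_one _)))).trans (hkey t))
  refine ⟨β, α, ?_⟩
  have h1 : Tendsto (fun t => (a t - α) * Real.cos (ω * t)) atTop (𝓝 0) :=
    Tendsto.zero_mul_isBoundedUnder_le (by simpa using hα.sub_const α)
      (isBoundedUnder_of ⟨1, fun t => Real.abs_cos_le_one _⟩)
  have h2 : Tendsto (fun t => (b t - β) * Real.sin (ω * t)) atTop (𝓝 0) :=
    Tendsto.zero_mul_isBoundedUnder_le (by simpa using hβ.sub_const β)
      (isBoundedUnder_of ⟨1, fun t => Real.abs_sin_le_one _⟩)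
  have h3 := h1.add h2
  rw [add_zero] at h3
  refine h3.congr fun t => ?_
  rw [hrot t]
  ring

/-! ### The convolutions `y₁` and `y₂` -/

theorem hasDerivAt_integral_of_continuousOn {k : ℝ → ℝ} (hk : ContinuousOn k (Ici 0)) {t : ℝ}
    (ht : 0 < t) : HasDerivAt (fun u => ∫ s in (0 : ℝ)..u, k s) (k t) t := by
  refine intervalIntegral.integral_hasDerivAt_right ?_ ?_ (hk.continuousAt (Ici_mem_nhds ht))
  · exact (hk.mono (by rw [uIcc_of_le ht.le]; exact Icc_subset_Ici_self)).intervalIntegrable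
  · exact (hk.mono Ioi_subset_Ici_self).stronglyMeasurableAtFilter isOpen_Ioi t ht

theorem continuousOn_Ici_of_absolutelyContinuousOnInterval {g : ℝ → ℝ}
    (hg : ∀ T, 0 ≤ T → AbsolutelyContinuousOnInterval g 0 T) : ContinuousOn g (Ici 0) := by
  intro t ht
  have ht0 : (0 : ℝ) ≤ t := ht
  have h := (hg (t + 1) (by linarith)).continuousOn
  rw [uIcc_of_le (by linarith)] at h
  refine (h t ⟨ht0, by linarith⟩).mono_of_mem_nhdsWithin ?_
  rw [← Ici_inter_Iic]
  exact inter_mem self_mem_nhdsWithin (mem_nhdsWithin_of_mem_nhds (Iic_mem_nhds (lt_add_one t)))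

/-- Frees the integrand of t, so that the convolutions can be differentiated by the product rule. -/
theorem integral_exp_mul_eq (c : ℝ) (g : ℝ → ℝ) (t : ℝ) :
    ∫ s in (0 : ℝ)..t, Real.exp (-c * (t - s)) * g s =
      Real.exp (-c * t) * ∫ s in (0 : ℝ)..t, Real.exp (c * s) * g s := by
  rw [← intervalIntegral.integral_const_mul]
  congr 1 with s
  rw [← mul_assoc, ← Real.exp_add]
  ring_nf

theorem hasDerivAt_exp_mul (c t : ℝ) :
    HasDerivAt (fun t => Real.exp (c * t)) (c * Real.exp (c * t)) t := by
  simpa [mul_comm] using ((hasDerivAt_id t).const_mul c).exp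

theorem absolutelyContinuousOnInterval_y₁ (ω : ℝ) {f : ℝ → ℝ} {T : ℝ}
    (hf : IntervalIntegrable f volume 0 T) : AbsolutelyContinuousOnInterval (y₁ ω f) 0 T := by
  have h1 : y₁ ω f = (fun t => Real.exp (-ω ^ 2 * t)) *
      fun t => ∫ s in (0 : ℝ)..t, Real.exp (ω ^ 2 * s) * f s :=
    funext fun t => integral_exp_mul_eq (ω ^ 2) f t
  rw [h1]
  refine AbsolutelyContinuousOnInterval.mul
    (ContDiff.contDiffOn (by fun_prop)).absolutelyContinuousOnInterval ?_
  exact (hf.continuousOn_mul (f := f) (by fun_prop)).absolutelyContinuousOnInterval_intervalIntegral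
    left_mem_uIcc

theorem ae_hasDerivAt_y₁ (ω : ℝ) {f : ℝ → ℝ} {T : ℝ} (hf : IntervalIntegrable f volume 0 T) :
    ∀ᵐ t, t ∈ uIcc 0 T → HasDerivAt (y₁ ω f) (f t - ω ^ 2 * y₁ ω f t) t := by
  have h1 : y₁ ω f = (fun t => Real.exp (-ω ^ 2 * t)) *
      fun t => ∫ s in (0 : ℝ)..t, Real.exp (ω ^ 2 * s) * f s :=
    funext fun t => integral_exp_mul_eq (ω ^ 2) f t
  filter_upwards [(hf.continuousOn_mul (f := f) (g := fun s => Real.exp (ω ^ 2 * s))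
    (by fun_prop)).ae_hasDerivAt_integral] with t ht htT
  have h2 := (hasDerivAt_exp_mul (-ω ^ 2) t).mul (ht htT 0 left_mem_uIcc)
  rw [h1]
  refine h2.congr_deriv ?_
  have h3 : Real.exp (-ω ^ 2 * t) * Real.exp (ω ^ 2 * t) = 1 := by
    rw [← Real.exp_add]
    simp
  simp only [Pi.mul_apply]
  linear_combination f t * h3

theorem hasDerivAt_y₂ (ω : ℝ) {f : ℝ → ℝ} (hf : ContinuousOn (y₁ ω f) (Ici 0)) {t : ℝ}
    (ht : 0 < t) : HasDerivAt (y₂ ω f) (y₁ ω f t - ω ^ 2 * y₂ ω f t) t := by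
  have h1 : y₂ ω f = (fun t => Real.exp (-ω ^ 2 * t)) *
      fun t => ∫ s in (0 : ℝ)..t, Real.exp (ω ^ 2 * s) * y₁ ω f s :=
    funext fun t => integral_exp_mul_eq (ω ^ 2) (y₁ ω f) t
  have h2 := (hasDerivAt_exp_mul (-ω ^ 2) t).mul (hasDerivAt_integral_of_continuousOn
    (k := fun s => Real.exp (ω ^ 2 * s) * y₁ ω f s) (by fun_prop) ht)
  rw [h1]
  refine h2.congr_deriv ?_
  have h3 : Real.exp (-ω ^ 2 * t) * Real.exp (ω ^ 2 * t) = 1 := by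
    rw [← Real.exp_add]
    simp
  simp only [Pi.mul_apply]
  linear_combination y₁ ω f t * h3

/-! ### The damping coefficient -/

theorem IsDamping.hasDerivAt {p : ℝ → ℝ} (hp : IsDamping p) {t : ℝ} (ht : 0 < t) :
    HasDerivAt p (derivWithin p (Ici 0) t) t :=
  ((hp.contDiffOn.differentiableOn one_ne_zero) t ht.le).hasDerivWithinAt.hasDerivAt
    (Ici_mem_nhds ht)

theorem IsDamping.antitoneOn {p : ℝ → ℝ} (hp : IsDamping p) : AntitoneOn p (Ici 0) := by
  refine antitoneOn_of_deriv_nonpos (convex_Ici 0) hp.contDiffOn.continuousOn ?_ ?_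
  · rw [interior_Ici]
    exact fun t ht => (hp.hasDerivAt ht).differentiableAt.differentiableWithinAt
  · rw [interior_Ici]
    intro t ht
    rw [(hp.hasDerivAt ht).deriv]
    exact (hp.deriv_neg t (le_of_lt ht)).le

/-- A decreasing positive p has a limit at infinity, and its derivative has constant sign. -/
theorem IsDamping.integrableOn_derivWithin {p : ℝ → ℝ} (hp : IsDamping p) :
    IntegrableOn (derivWithin p (Ici 0)) (Ioi 0) := by
  have hlim : ∃ l, Tendsto p atTop (𝓝 l) := by
    have hanti : Antitone fun t => p (max t 0) := fun s t hst =>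
      hp.antitoneOn (mem_Ici.2 (le_max_right _ _)) (mem_Ici.2 (le_max_right _ _))
        (max_le_max_right 0 hst)
    refine ⟨_, (tendsto_atTop_ciInf hanti ⟨0, ?_⟩).congr' ?_⟩
    · rintro _ ⟨t, rfl⟩
      exact (hp.pos _ (le_max_right _ _)).le
    · filter_upwards [eventually_ge_atTop 0] with t ht
      rw [max_eq_left ht]
  obtain ⟨l, hl⟩ := hlim
  exact integrableOn_Ioi_deriv_of_nonpos (hp.contDiffOn.continuousOn 0 self_mem_Ici)
    (fun t ht => hp.hasDerivAt ht) (fun t ht => (hp.deriv_neg t (le_of_lt ht)).le) hl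

theorem hasDerivAt_A {p : ℝ → ℝ} (hp : ContinuousOn p (Ici 0)) {t : ℝ} (ht : 0 < t) :
    HasDerivAt (A p) (A p t * (p t / 2)) t := by
  refine ((hasDerivAt_integral_of_continuousOn hp ht).const_mul (1 / 2)).exp.congr_deriv ?_
  rw [A]
  ring

theorem A_pos (p : ℝ → ℝ) (t : ℝ) : 0 < A p t := Real.exp_pos _

/-! ### Removing the rough forcing -/

/-- The velocity of a solution differs from `y₁` by a function that is differentiable
everywhere. -/
theorem hasDerivAt_velocity_sub_y₁ {ω : ℝ} {p f x v : ℝ → ℝ} (hp : ContinuousOn p (Ici 0))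
    (hf : ∀ T, 0 ≤ T → IntervalIntegrable f volume 0 T) (hx : ContinuousOn x (Ici 0))
    (hv : ∀ T, 0 ≤ T → AbsolutelyContinuousOnInterval v 0 T)
    (heq : ∀ᵐ t, 0 ≤ t → ∃ a : ℝ, HasDerivAt v a t ∧ a + p t * v t + ω ^ 2 * x t = f t)
    {t : ℝ} (ht : 0 < t) :
    HasDerivAt (fun t => v t - y₁ ω f t)
      (-p t * v t - ω ^ 2 * x t + ω ^ 2 * y₁ ω f t) t := by
  have hvc := continuousOn_Ici_of_absolutelyContinuousOnInterval hv
  have hyc := continuousOn_Ici_of_absolutelyContinuousOnInterval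
    fun T hT => absolutelyContinuousOnInterval_y₁ ω (hf T hT)
  set k : ℝ → ℝ := fun t => -p t * v t - ω ^ 2 * x t + ω ^ 2 * y₁ ω f t with hk
  have hkc : ContinuousOn k (Ici 0) := by fun_prop
  -- In the a.e. derivative of v - y₁ the two copies of f cancel, leaving the continuous k. Absolute
  -- continuity makes v - y₁ a primitive of k, so the derivative exists at every t > 0.
  have hint : ∀ u, 0 ≤ u →
      ∫ s in (0 : ℝ)..u, k s = (v u - y₁ ω f u) - (v 0 - y₁ ω f 0) := by
    intro u hu
    rw [← ((hv u hu).fun_sub (absolutelyContinuousOnInterval_y₁ ω (hf u hu))).integral_deriv_eq_sub]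
    refine intervalIntegral.integral_congr_ae ?_
    filter_upwards [heq, ae_hasDerivAt_y₁ ω (hf u hu)] with s hs1 hs2 hs
    have hs' := uIoc_subset_uIcc hs
    obtain ⟨a, ha, hae⟩ := hs1 (by rw [uIcc_of_le hu] at hs'; exact hs'.1)
    rw [(ha.fun_sub (hs2 hs')).deriv]
    simp only [hk]
    linear_combination -hae
  refine ((hasDerivAt_integral_of_continuousOn hkc ht).add_const
    (v 0 - y₁ ω f 0)).congr_of_eventuallyEq ?_
  filter_upwards [Ioi_mem_nhds ht] with u hu
  rw [hint u (le_of_lt hu)]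
  ring

end DampedOscillator

open DampedOscillator in
theorem mainTheorem3 (ω : ℝ) (hω : ω ≠ 0) (p f : ℝ → ℝ)
    (hp : DampedOscillator.IsDamping p) (hf : LocallyIntegrableOn f (Ici 0))
    (ξ₀ ξ₁ : ℝ) (x : ℝ → ℝ) (hx : DampedOscillator.IsSolution ω p f ξ₀ ξ₁ x)
    (hy : DampedOscillator.y₂ ω f =o[atTop] fun t => 1 / DampedOscillator.A p t)
    (hyint : IntegrableOn
      (fun s => DampedOscillator.A p s * |DampedOscillator.y₂ ω f s|) (Ici 0)) :
    ∃ c₁ c₂ : ℝ,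
      (fun t => x t
          - (c₁ * Real.sin (ω * t) + c₂ * Real.cos (ω * t)) / DampedOscillator.A p t)
        =o[atTop] fun t => 1 / DampedOscillator.A p t := by
  obtain ⟨v, hxv, hv, heq, -, -⟩ := hx
  have hfi : ∀ T, 0 ≤ T → IntervalIntegrable f volume 0 T := fun T hT =>
    intervalIntegrable_iff_integrableOn_Icc_of_le hT |>.2
      (hf.integrableOn_compact_subset Icc_subset_Ici_self isCompact_Icc)
  have hpc := hp.contDiffOn.continuousOn
  have hyc := continuousOn_Ici_of_absolutelyContinuousOnInterval
    fun T hT => absolutelyContinuousOnInterval_y₁ ω (hfi T hT)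
  have hxc : ContinuousOn x (Ici 0) := fun t ht => (hxv t ht).continuousWithinAt
  have hxd : ∀ t, 0 < t → HasDerivAt x (v t) t := fun t ht =>
    (hxv t ht.le).hasDerivAt (Ici_mem_nhds ht)
  have hy2 : ∀ t, 0 < t → HasDerivAt (y₂ ω f) (y₁ ω f t - ω ^ 2 * y₂ ω f t) t :=
    fun t ht => hasDerivAt_y₂ ω hyc ht
  set p' : ℝ → ℝ := derivWithin p (Ici 0)
  have hAne : ∀ t, A p t ≠ 0 := fun t => (A_pos p t).ne'
  have hAy : Tendsto (fun t => A p t * y₂ ω f t) atTop (𝓝 0) := by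
    refine ((isLittleO_iff_tendsto fun t h => absurd h (by simp [hAne])).1 hy).congr fun t => ?_
    rw [div_div_eq_mul_div, div_one, mul_comm]
  -- Past T the factor A y₂ is bounded, which makes A y₂ p' integrable.
  obtain ⟨T, hT0, hT⟩ : ∃ T : ℝ, 0 ≤ T ∧ ∀ t, T < t → |A p t * y₂ ω f t| ≤ 1 := by
    have h := hAy.abs.eventually_le_const (u := 1) (by simp)
    obtain ⟨T, hT⟩ := eventually_atTop.1 h
    exact ⟨max T 0, le_max_right _ _, fun t ht => hT t ((le_max_left _ _).trans ht.le)⟩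
  have hsub : Ioi T ⊆ Ici 0 := fun t ht => hT0.trans (le_of_lt ht)
  have hsub' : Ioi T ⊆ Ioi 0 := Ioi_subset_Ioi hT0
  have hAyc : ContinuousOn (fun t => A p t * y₂ ω f t) (Ioi T) := fun t ht =>
    ((hasDerivAt_A hpc (hsub' ht)).mul (hy2 t (hsub' ht))).continuousAt.continuousWithinAt
  have hAyi : IntegrableOn (fun t => A p t * y₂ ω f t) (Ioi T) := by
    refine Integrable.mono (hyint.mono_set hsub) (hAyc.aestronglyMeasurable measurableSet_Ioi)
      (Eventually.of_forall fun t => ?_)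
    simp
  have hpT : ContinuousOn p (Ioi T) := hpc.mono hsub
  have hpb : ∀ t, T < t → |p t| ≤ p 0 := fun t ht => by
    rw [abs_of_pos (hp.pos t (hsub ht))]
    exact hp.antitoneOn self_mem_Ici (hsub ht) (hsub ht)
  have hp'i : IntegrableOn p' (Ioi T) := hp.integrableOn_derivWithin.mono_set hsub'
  have hpAy : IntegrableOn (fun t => p t * (A p t * y₂ ω f t)) (Ioi T) := by
    refine hAyi.bdd_mul (c := p 0) (hpT.aestronglyMeasurable measurableSet_Ioi) ?_
    filter_upwards [self_mem_ae_restrict measurableSet_Ioi] with t ht using hpb t ht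
  have hppAy : IntegrableOn (fun t => p t * (p t * (A p t * y₂ ω f t))) (Ioi T) := by
    refine hpAy.bdd_mul (c := p 0) (hpT.aestronglyMeasurable measurableSet_Ioi) ?_
    filter_upwards [self_mem_ae_restrict measurableSet_Ioi] with t ht using hpb t ht
  have hp'Ay : IntegrableOn (fun t => (A p t * y₂ ω f t) * p' t) (Ioi T) := by
    refine hp'i.bdd_mul (c := 1) (hAyc.aestronglyMeasurable measurableSet_Ioi) ?_
    filter_upwards [self_mem_ae_restrict measurableSet_Ioi] with t ht using hT t ht
  obtain ⟨c₁, c₂, hc⟩ := exists_tendsto_sub_harmonic hω (T := T)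
    (u := fun t => A p t * (x t - y₂ ω f t))
    -- Here w = u' - (2ω² - p) A y₂, with z' = (v - y₁) + ω² y₂. Subtracting (2ω² - p) y₂ cancels
    -- the y₂' term in w', at the cost of the p' y₂ term in s and of r in u'.
    (w := fun t => A p t * ((v t - y₁ ω f t) + ω ^ 2 * y₂ ω f t - (2 * ω ^ 2 - p t) * y₂ ω f t
      + p t / 2 * (x t - y₂ ω f t)))
    (q := fun t => 1 / 2 * p' t + 1 / 4 * p t ^ 2)
    (r := fun t => 2 * ω ^ 2 * (A p t * y₂ ω f t) - p t * (A p t * y₂ ω f t))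
    (s := fun t => (A p t * y₂ ω f t) * p' t + -ω ^ 2 * (p t * (A p t * y₂ ω f t))
      + 1 / 2 * (p t * (p t * (A p t * y₂ ω f t))) + (ω ^ 4 - ω ^ 2) * (A p t * y₂ ω f t))
    (fun t ht => by
      have ht0 : 0 < t := hsub' ht
      refine ((hasDerivAt_A hpc ht0).mul ((hxd t ht0).sub (hy2 t ht0))).congr_deriv ?_
      simp only [Pi.sub_apply]
      ring)
    (fun t ht => by
      have ht0 : 0 < t := hsub' ht
      have hV := hasDerivAt_velocity_sub_y₁ hpc hfi hxc hv heq ht0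
      have hP : HasDerivAt p (p' t) t := hp.hasDerivAt ht0
      refine ((hasDerivAt_A hpc ht0).mul (((hV.add ((hy2 t ht0).const_mul (ω ^ 2))).sub
        ((hP.const_sub (2 * ω ^ 2)).mul (hy2 t ht0))).add
        ((hP.div_const 2).mul ((hxd t ht0).sub (hy2 t ht0))))).congr_deriv ?_
      simp only [Pi.add_apply, Pi.sub_apply, Pi.mul_apply]
      ring)
    ((hp'i.const_mul (1 / 2)).fun_add ((hp.sq_integrable.mono_set hsub).const_mul (1 / 4)))
    (Integrable.sub (hAyi.const_mul (2 * ω ^ 2)) hpAy)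
    ((Integrable.fun_add (Integrable.fun_add hp'Ay (hpAy.const_mul (-ω ^ 2))) (hppAy.const_mul (1 / 2))).fun_add
      (hAyi.const_mul (ω ^ 4 - ω ^ 2)))
  refine ⟨c₁, c₂, (isLittleO_iff_tendsto fun t h => absurd h (by simp [hAne])).2 ?_⟩
  -- Adding A y₂ → 0 turns u = A (x - y₂) back into A x.
  have h := hc.add hAy
  rw [add_zero] at h
  refine h.congr fun t => ?_
  field_simp [hAne t]
  ring
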